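/- Local maximum principle for the $\Gamma$-hull. For each $z\in\mathbb C^k$ let $\Gamma_z$ be a closed cone of $(1,0)$-vectors at $z$ containing a nonzero vector, and assume that $\Gamma=\bigcup_{z\in\mathbb C^k}\{z\}\times\Gamma_z$ is closed in $\mathbb C^k\times\mathbb C^k$ (a $(1,0)$-vector $\sum_j\xi_j\,\partial/\partial z_j$ is identified with $\xi\in\mathbb C^k$). Let $\mathcal P_\Gamma$ be the set of real-valued $u\in\mathcal C^2(\mathbb C^k)$ such that $$\sum_{j,l}\frac{\partial^2u}{\partial z_j\partial\bar z_l}(z)\,\xi_j\bar\xi_l\ge 0\qquad\text{for all } z\in\mathbb C^k,\ \xi\in\Gamma_z,$$ and let $\overline{\mathcal P}_\Gamma$ be the set of pointwise limits $v:\mathbb C^k\to[-\infty,\infty)$ of decreasing sequences of functions in $\mathcal P_\Gamma$. For a compact set $K\subset\mathbb C^k$ let $$\widehat K_\Gamma=\{z\in\mathbb C^k:\ u(z)\le\sup_K u\ \text{ for every } u\in\mathcal P_\Gamma\}.$$ Let $K\subset\mathbb C^k$ be compact and let $U\Subset\mathbb C^k$ be open. Then for every $v\in\overline{\mathcal P}_\Gamma$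 and every $x\in U\cap\widehat K_\Gamma$, $$v(x)\le\sup_{(\partial U\cap\widehat K_\Gamma)\cup(U\cap K)}v .$$ Likewise (Rossi's local maximum principle for plurisubharmonic functions), let $\mathcal P_0$ be the set of smooth ($\mathcal C^\infty$) plurisubharmonic functions on $\mathbb C^k$ and $\widehat K=\{z\in\mathbb C^k:\ u(z)\le\sup_K u\ \text{ for every } u\in\mathcal P_0\}$. Then for every pointwise limit $v:\mathbb C^k\to[-\infty,\infty)$ of a decreasing sequence in $\mathcal P_0$ and every $x\in U\cap\widehat K$, $$v(x)\le\sup_{(\partial U\cap\widehat K)\cup(U\cap K)}v .$$ Here suprema are taken in $[-\infty,\infty]$, with $\sup_\emptyset=-\infty$. -/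

import Mathlib

open Filter Topology
open scoped ContDiff

noncomputable section

namespace GammaHull

/-- The space `ℂ^k` with its Euclidean norm. A `(1,0)`-vector `∑ j, ξ j ∂/∂z_j` at a point is
identified with its coefficient vector `ξ`. -/
abbrev Cn (k : ℕ) : Type := EuclideanSpace ℂ (Fin k)

/-- The second real derivative of `u` at `z` in the directions `v`, `w`. -/
def secondDeriv {k : ℕ} (u : Cn k → ℝ) (z v w : Cn k) : ℝ :=
  fderiv ℝ (fderiv ℝ u) z v w

/-- The vector `∂/∂x_j`, where `z_j = x_j + i y_j`. -/
def dx {k : ℕ} (j : Fin k) : Cn k := EuclideanSpace.single j 1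

/-- The vector `∂/∂y_j`, where `z_j = x_j + i y_j`. -/
def dy {k : ℕ} (j : Fin k) : Cn k := EuclideanSpace.single j Complex.I

/-- The complex Hessian entry `∂²u / ∂z_j ∂z̄_l`, where `∂/∂z_j = (∂/∂x_j - i ∂/∂y_j) / 2` and
`∂/∂z̄_l = (∂/∂x_l + i ∂/∂y_l) / 2`. -/
def complexHessian {k : ℕ} (u : Cn k → ℝ) (z : Cn k) (j l : Fin k) : ℂ :=
  ((secondDeriv u z (dx j) (dx l) + secondDeriv u z (dy j) (dy l) : ℝ) +
    (secondDeriv u z (dx j) (dy l) - secondDeriv u z (dy j) (dx l) : ℝ) * Complex.I) / 4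

/-- The Levi form `∑ j l, (∂²u / ∂z_j ∂z̄_l)(z) ξ_j ξ̄_l`, that is, `i∂∂̄u(z)` evaluated on the
bivector `iξ ∧ ξ̄` up to a positive constant. For `u` of class `C²` the sum is real. -/
def leviForm {k : ℕ} (u : Cn k → ℝ) (z ξ : Cn k) : ℝ :=
  (∑ j, ∑ l, complexHessian u z j l * ξ j * (starRingEnd ℂ) (ξ l)).re

/-- The Levi form is a quarter of the real Laplacian of `ζ ↦ u (z + ζ ξ)` at `ζ = 0`. -/
theorem leviForm_eq {k : ℕ} (u : Cn k → ℝ) (z ξ : Cn k) :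
    leviForm u z ξ =
      (secondDeriv u z ξ ξ + secondDeriv u z (Complex.I • ξ) (Complex.I • ξ)) / 4 := by
  have h1 : ξ = ∑ j, ((ξ j).re • dx j + (ξ j).im • dy j : Cn k) := by
    ext i
    simp [dx, dy, Finset.sum_apply, Pi.single_apply, Finset.sum_add_distrib, Complex.re_add_im]
  have h2 : Complex.I • ξ = ∑ j, ((-(ξ j).im) • dx j + (ξ j).re • dy j : Cn k) := by
    ext i
    simp [dx, dy, Finset.sum_apply, Pi.single_apply, Finset.sum_add_distrib]
    apply Complex.ext <;> simp
  have key : ∀ a b : Fin k → ℝ,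
      secondDeriv u z (∑ j, (a j • dx j + b j • dy j : Cn k))
        (∑ j, (a j • dx j + b j • dy j : Cn k)) =
      ∑ j, ∑ l, (a j * a l * secondDeriv u z (dx j) (dx l)
        + a j * b l * secondDeriv u z (dx j) (dy l)
        + b j * a l * secondDeriv u z (dy j) (dx l)
        + b j * b l * secondDeriv u z (dy j) (dy l)) := by
    intro a b
    simp only [secondDeriv, map_sum, sum_apply, map_add, map_smul,
      add_apply, smul_apply, smul_eq_mul]
    rw [Finset.sum_comm]
    refine Finset.sum_congr rfl fun j _ => ?_
    rw [Finset.mul_sum, Finset.mul_sum, ← Finset.sum_add_distrib]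
    refine Finset.sum_congr rfl fun l _ => ?_
    ring
  rw [h2, show secondDeriv u z ξ ξ = _ from by rw [h1, key], key, leviForm, Complex.re_sum,
    ← Finset.sum_add_distrib, Finset.sum_div]
  refine Finset.sum_congr rfl fun j _ => ?_
  rw [Complex.re_sum, ← Finset.sum_add_distrib, Finset.sum_div]
  refine Finset.sum_congr rfl fun l _ => ?_
  simp [complexHessian]
  ring

/-- A closed field `z ↦ Γ z` of closed cones of `(1,0)`-vectors on `ℂ^k`, each of which contains
a nonzero vector. -/
structure IsClosedConeField {k : ℕ} (Γ : Cn k → Set (Cn k)) : Prop where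
  smul_mem : ∀ z, ∀ ξ ∈ Γ z, ∀ t : ℝ, 0 < t → t • ξ ∈ Γ z
  isClosed_fiber : ∀ z, IsClosed (Γ z)
  exists_ne_zero : ∀ z, ∃ ξ ∈ Γ z, ξ ≠ 0
  isClosed_total : IsClosed {p : Cn k × Cn k | p.2 ∈ Γ p.1}

/-- The cone of real `C²` functions on `ℂ^k` whose Levi form at each `z` is nonnegative
on `Γ z`. -/
def coneP {k : ℕ} (Γ : Cn k → Set (Cn k)) : Set (Cn k → ℝ) :=
  {u | ContDiff ℝ 2 u ∧ ∀ z, ∀ ξ ∈ Γ z, 0 ≤ leviForm u z ξ}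

/-- The cone of smooth plurisubharmonic functions on `ℂ^k`. -/
def smoothPsh (k : ℕ) : Set (Cn k → ℝ) :=
  {u | ContDiff ℝ ∞ u ∧ ∀ z ξ, 0 ≤ leviForm u z ξ}

/-- The pointwise limits, with values in `[-∞, ∞)`, of decreasing sequences of functions
of `P`. -/
def decreasingLimits {k : ℕ} (P : Set (Cn k → ℝ)) : Set (Cn k → EReal) :=
  {v | ∃ u : ℕ → Cn k → ℝ, (∀ n, u n ∈ P) ∧ Antitone u ∧
    ∀ z, Tendsto (fun n => (u n z : EReal)) atTop (𝓝 (v z))}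

/-- The hull of `K` with respect to `P`: the points `z` with `u z ≤ sup_K u` for all `u ∈ P`.
The supremum is taken in `[-∞, ∞]`, so the hull of the empty set is empty if `P` is not. -/
def hull {k : ℕ} (P : Set (Cn k → ℝ)) (K : Set (Cn k)) : Set (Cn k) :=
  {z | ∀ u ∈ P, (u z : EReal) ≤ ⨆ y ∈ K, (u y : EReal)}

end GammaHull

end

/-!
Let `P` be either cone of functions, `K̂` its hull of `K`, and let `v ∈ P` be `< c` on
`(∂U ∩ K̂) ∪ (U ∩ K)`. The part of `∂U` where `v ≥ c` is compact and misses `K̂`, so some `w ∈ P`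
with `w ≥ c` equals `c` on `K` and exceeds `v` on `∂U`. For a smooth convex ramp `χ` with slopes in
`[0, 1]` which vanishes exactly on `(-∞, 0]`, the regularised maximum `w + χ(v - w)` belongs to `P`
and agrees with `w` near `∂U`, so replacing it by `w` outside `U` gives another function of `P`. It
equals `c` on `K`, hence is `≤ c` on `K̂`; therefore `v ≤ c` on `U ∩ K̂`. For a decreasing limit
`v`, compactness of `(∂U ∩ K̂) ∪ (U ∩ K)` carries a strict bound on `v` over to some term of the
sequence.
-/

namespace GammaHull

/-- The ramp `t ↦ t * exp (-1 / t)` for `t > 0`, and `0` for `t ≤ 0`: a smooth convex function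
with slopes in `[0, 1]` whose zero set is `(-∞, 0]`. -/
noncomputable def smoothRamp (t : ℝ) : ℝ := t * expNegInvGlue t

theorem contDiff_smoothRamp : ContDiff ℝ ∞ smoothRamp :=
  contDiff_id.mul expNegInvGlue.contDiff

theorem smoothRamp_of_nonpos {t : ℝ} (ht : t ≤ 0) : smoothRamp t = 0 := by
  rw [smoothRamp, expNegInvGlue.zero_of_nonpos ht, mul_zero]

theorem smoothRamp_pos {t : ℝ} (ht : 0 < t) : 0 < smoothRamp t :=
  mul_pos ht (expNegInvGlue.pos_of_pos ht)

theorem deriv_smoothRamp : deriv smoothRamp = fun t => (1 + t⁻¹) * expNegInvGlue t := by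
  funext t
  have hglue : HasDerivAt expNegInvGlue (t⁻¹ ^ 2 * expNegInvGlue t) t := by
    simpa using expNegInvGlue.hasDerivAt_polynomial_eval_inv_mul 1 t
  have hramp := (hasDerivAt_id t).mul hglue
  refine (hramp.congr_deriv ?_).deriv
  rcases eq_or_ne t 0 with rfl | ht
  · simp
  · simp only [id_eq]
    field_simp

theorem deriv_deriv_smoothRamp :
    deriv (deriv smoothRamp) = fun t => t⁻¹ ^ 3 * expNegInvGlue t := by
  funext t
  rw [deriv_smoothRamp]
  have h := expNegInvGlue.hasDerivAt_polynomial_eval_inv_mul (1 + Polynomial.X) t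
  simp only [Polynomial.eval_add, Polynomial.eval_one, Polynomial.eval_X] at h
  refine (h.congr_deriv ?_).deriv
  have hpoly : Polynomial.X ^ 2 * (1 + Polynomial.X - Polynomial.derivative (1 + Polynomial.X)) =
      (Polynomial.X ^ 3 : Polynomial ℝ) := by
    simp only [Polynomial.derivative_add, Polynomial.derivative_one, Polynomial.derivative_X]
    ring
  rw [hpoly, Polynomial.eval_pow, Polynomial.eval_X]

theorem convexOn_smoothRamp : ConvexOn ℝ Set.univ smoothRamp := by
  have hsmooth : ContDiff ℝ 2 smoothRamp := contDiff_smoothRamp.of_le ENat.LEInfty.out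
  refine convexOn_univ_of_deriv2_nonneg (hsmooth.differentiable two_ne_zero)
    ((hsmooth.deriv' (n := 1)).differentiable one_ne_zero) fun t => ?_
  rw [Function.iterate_succ_apply, Function.iterate_one, deriv_deriv_smoothRamp]
  rcases le_or_gt t 0 with ht | ht
  · simp [expNegInvGlue.zero_of_nonpos ht]
  · exact mul_nonneg (by positivity) (expNegInvGlue.nonneg t)

theorem deriv_smoothRamp_mem_Icc (t : ℝ) : deriv smoothRamp t ∈ Set.Icc 0 1 := by
  rw [deriv_smoothRamp]
  rcases le_or_gt t 0 with ht | ht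
  · simp [expNegInvGlue.zero_of_nonpos ht]
  · refine ⟨mul_nonneg (by positivity) (expNegInvGlue.nonneg t), ?_⟩
    calc (1 + t⁻¹) * expNegInvGlue t
        = (t⁻¹ + 1) * Real.exp (-t⁻¹) := by rw [expNegInvGlue, if_neg ht.not_ge, add_comm]
      _ ≤ Real.exp t⁻¹ * Real.exp (-t⁻¹) := by gcongr; exact Real.add_one_le_exp _
      _ = 1 := by rw [← Real.exp_add, add_neg_cancel, Real.exp_zero]

/-- A one-sided smooth substitute for the maximum of `a` and `b`: it equals `b` if `a ≤ b` and
exceeds `b` otherwise, but it need not be `≥ a`. -/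
noncomputable def regMax (a b : ℝ) : ℝ := b + smoothRamp (a - b)

theorem regMax_of_le {a b : ℝ} (h : a ≤ b) : regMax a b = b := by
  rw [regMax, smoothRamp_of_nonpos (sub_nonpos.2 h), add_zero]

theorem right_lt_regMax {a b : ℝ} (h : b < a) : b < regMax a b :=
  lt_add_of_pos_right b (smoothRamp_pos (sub_pos.2 h))

theorem right_le_regMax (a b : ℝ) : b ≤ regMax a b := by
  rcases le_or_gt a b with h | h
  · exact (regMax_of_le h).ge
  · exact (right_lt_regMax h).le

section SecondDerivative

variable {E F : Type*} [NormedAddCommGroup E] [NormedSpace ℝ E] [NormedAddCommGroup F]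
  [NormedSpace ℝ F]

theorem differentiable_fderiv {u : E → F} (hu : ContDiff ℝ 2 u) : Differentiable ℝ (fderiv ℝ u) :=
  (hu.fderiv_right (m := 1) one_add_one_eq_two.le).differentiable one_ne_zero

theorem fderiv_fderiv_add {u w : E → F} (hu : ContDiff ℝ 2 u) (hw : ContDiff ℝ 2 w) (z : E) :
    fderiv ℝ (fderiv ℝ (u + w)) z = fderiv ℝ (fderiv ℝ u) z + fderiv ℝ (fderiv ℝ w) z := by
  have h : fderiv ℝ (u + w) = fderiv ℝ u + fderiv ℝ w := funext fun x =>
    fderiv_add (hu.differentiable two_ne_zero x) (hw.differentiable two_ne_zero x)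
  rw [h, fderiv_add (differentiable_fderiv hu z) (differentiable_fderiv hw z)]

theorem fderiv_fderiv_comp_apply {χ : ℝ → ℝ} {u : E → ℝ} (hχ : ContDiff ℝ 2 χ)
    (hu : ContDiff ℝ 2 u) (z a b : E) :
    fderiv ℝ (fderiv ℝ (χ ∘ u)) z a b = deriv χ (u z) * fderiv ℝ (fderiv ℝ u) z a b +
      deriv (deriv χ) (u z) * fderiv ℝ u z a * fderiv ℝ u z b := by
  have hdu (x : E) : HasFDerivAt u (fderiv ℝ u x) x :=
    (hu.differentiable two_ne_zero x).hasFDerivAt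
  have hcomp : fderiv ℝ (χ ∘ u) = (deriv χ ∘ u) • fderiv ℝ u := funext fun x =>
    ((hχ.differentiable two_ne_zero (u x)).hasDerivAt.comp_hasFDerivAt x (hdu x)).fderiv
  have hχ' : Differentiable ℝ (deriv χ) := (hχ.deriv' (n := 1)).differentiable one_ne_zero
  have hcoeff : HasFDerivAt (deriv χ ∘ u) (deriv (deriv χ) (u z) • fderiv ℝ u z) z :=
    (hχ' (u z)).hasDerivAt.comp_hasFDerivAt z (hdu z)
  rw [hcomp, (hcoeff.smul (differentiable_fderiv hu z).hasFDerivAt).fderiv]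
  simp

end SecondDerivative

variable {k : ℕ}

theorem leviForm_add {u w : Cn k → ℝ} (hu : ContDiff ℝ 2 u) (hw : ContDiff ℝ 2 w) (z ξ : Cn k) :
    leviForm (u + w) z ξ = leviForm u z ξ + leviForm w z ξ := by
  simp only [leviForm_eq, secondDeriv, fderiv_fderiv_add hu hw, add_apply]
  ring

theorem leviForm_sub {u w : Cn k → ℝ} (hu : ContDiff ℝ 2 u) (hw : ContDiff ℝ 2 w) (z ξ : Cn k) :
    leviForm (u - w) z ξ = leviForm u z ξ - leviForm w z ξ := by
  have hdiff : ContDiff ℝ 2 (u - w) := hu.sub hw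
  rw [eq_sub_iff_add_eq, ← leviForm_add hdiff hw, sub_add_cancel]

theorem leviForm_comp {χ : ℝ → ℝ} {u : Cn k → ℝ} (hχ : ContDiff ℝ 2 χ) (hu : ContDiff ℝ 2 u)
    (z ξ : Cn k) :
    leviForm (χ ∘ u) z ξ = deriv χ (u z) * leviForm u z ξ + deriv (deriv χ) (u z) *
      ((fderiv ℝ u z ξ ^ 2 + fderiv ℝ u z (Complex.I • ξ) ^ 2) / 4) := by
  simp only [leviForm_eq, secondDeriv, fderiv_fderiv_comp_apply hχ hu]
  ring

theorem leviForm_const (c : ℝ) (z ξ : Cn k) : leviForm (fun _ => c) z ξ = 0 := by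
  simp [leviForm_eq, secondDeriv]

theorem leviForm_const_smul {u : Cn k → ℝ} (hu : ContDiff ℝ 2 u) (c : ℝ) (z ξ : Cn k) :
    leviForm (c • u) z ξ = c * leviForm u z ξ := by
  have hderiv : deriv (fun t : ℝ => c * t) = fun _ => c := funext fun t => by simp
  have h := leviForm_comp (χ := fun t => c * t) (contDiff_const.mul contDiff_id) hu z ξ
  rw [hderiv, deriv_const, zero_mul, add_zero] at h
  exact h

theorem leviForm_congr {u w : Cn k → ℝ} {z : Cn k} (h : u =ᶠ[𝓝 z] w) (ξ : Cn k) :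
    leviForm u z ξ = leviForm w z ξ := by
  simp only [leviForm_eq, secondDeriv, h.fderiv.fderiv_eq]

theorem deriv_mul_leviForm_le_leviForm_comp {χ : ℝ → ℝ} {u : Cn k → ℝ} (hχ : ContDiff ℝ 2 χ)
    (hconv : ConvexOn ℝ Set.univ χ) (hu : ContDiff ℝ 2 u) (z ξ : Cn k) :
    deriv χ (u z) * leviForm u z ξ ≤ leviForm (χ ∘ u) z ξ := by
  have hmono : Monotone (deriv χ) := monotoneOn_univ.1 <|
    hconv.monotoneOn_deriv fun t _ => hχ.differentiable two_ne_zero t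
  rw [leviForm_comp hχ hu]
  exact le_add_of_nonneg_right (mul_nonneg hmono.deriv_nonneg (by positivity))

/-- The functions of class `C^n` whose Levi form at each `z` is nonnegative on `Γ z`, a common
generalisation of `coneP` (the case `n = 2`) and `smoothPsh` (the case `n = ∞`, `Γ z = ℂ^k`). -/
def leviCone (n : WithTop ℕ∞) (Γ : Cn k → Set (Cn k)) : Set (Cn k → ℝ) :=
  {u | ContDiff ℝ n u ∧ ∀ z, ∀ ξ ∈ Γ z, 0 ≤ leviForm u z ξ}

theorem smoothPsh_eq_leviCone (k : ℕ) : smoothPsh k = leviCone ∞ fun _ => Set.univ := by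
  simp only [smoothPsh, leviCone, Set.mem_univ, forall_const]

section LeviCone

variable {n : WithTop ℕ∞} {Γ : Cn k → Set (Cn k)} {u w : Cn k → ℝ}

theorem const_mem_leviCone (c : ℝ) : (fun _ => c) ∈ leviCone n Γ :=
  ⟨contDiff_const, fun z ξ _ => (leviForm_const c z ξ).ge⟩

theorem add_mem_leviCone (hn : 2 ≤ n) (hu : u ∈ leviCone n Γ) (hw : w ∈ leviCone n Γ) :
    u + w ∈ leviCone n Γ := by
  refine ⟨hu.1.add hw.1, fun z ξ hξ => ?_⟩
  rw [leviForm_add (hu.1.of_le hn) (hw.1.of_le hn)]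
  exact add_nonneg (hu.2 z ξ hξ) (hw.2 z ξ hξ)

theorem const_smul_mem_leviCone (hn : 2 ≤ n) {c : ℝ} (hc : 0 ≤ c) (hu : u ∈ leviCone n Γ) :
    c • u ∈ leviCone n Γ := by
  refine ⟨contDiff_const.smul hu.1, fun z ξ hξ => ?_⟩
  rw [leviForm_const_smul (hu.1.of_le hn)]
  exact mul_nonneg hc (hu.2 z ξ hξ)

theorem add_comp_sub_mem_leviCone (hn : 2 ≤ n) {χ : ℝ → ℝ} (hχ : ContDiff ℝ n χ)
    (hconv : ConvexOn ℝ Set.univ χ) (hslope : ∀ t, deriv χ t ∈ Set.Icc 0 1)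
    (hu : u ∈ leviCone n Γ) (hw : w ∈ leviCone n Γ) : w + χ ∘ (u - w) ∈ leviCone n Γ := by
  have hu₂ := hu.1.of_le hn
  have hw₂ := hw.1.of_le hn
  have hχ₂ := hχ.of_le hn
  refine ⟨hw.1.add (hχ.comp (hu.1.sub hw.1)), fun z ξ hξ => ?_⟩
  obtain ⟨hs₀, hs₁⟩ := hslope ((u - w) z)
  calc 0 ≤ (1 - deriv χ ((u - w) z)) * leviForm w z ξ + deriv χ ((u - w) z) * leviForm u z ξ :=
        add_nonneg (mul_nonneg (sub_nonneg.2 hs₁) (hw.2 z ξ hξ)) (mul_nonneg hs₀ (hu.2 z ξ hξ))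
    _ = leviForm w z ξ + deriv χ ((u - w) z) * leviForm (u - w) z ξ := by
        rw [leviForm_sub hu₂ hw₂]
        ring
    _ ≤ leviForm w z ξ + leviForm (χ ∘ (u - w)) z ξ := by
        gcongr
        exact deriv_mul_leviForm_le_leviForm_comp hχ₂ hconv (hu₂.sub hw₂) z ξ
    _ = leviForm (w + χ ∘ (u - w)) z ξ := (leviForm_add hw₂ (hχ₂.comp (hu₂.sub hw₂)) z ξ).symm

theorem regMax_mem_leviCone (hn : 2 ≤ n) (hn' : n ≤ ∞) (hu : u ∈ leviCone n Γ)
    (hw : w ∈ leviCone n Γ) : (fun z => regMax (u z) (w z)) ∈ leviCone n Γ :=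
  add_comp_sub_mem_leviCone hn (contDiff_smoothRamp.of_le hn') convexOn_smoothRamp
    deriv_smoothRamp_mem_Icc hu hw

theorem mem_leviCone_of_eventuallyEq (h : ∀ z, ∃ g ∈ leviCone n Γ, u =ᶠ[𝓝 z] g) :
    u ∈ leviCone n Γ := by
  choose g hg hug using h
  refine ⟨contDiff_iff_contDiffAt.2 fun z => (hg z).1.contDiffAt.congr_of_eventuallyEq (hug z),
    fun z ξ hξ => ?_⟩
  rw [leviForm_congr (hug z)]
  exact (hg z).2 z ξ hξ

end LeviCone

section Hull

variable {P : Set (Cn k → ℝ)} {K : Set (Cn k)}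

theorem subset_hull (P : Set (Cn k → ℝ)) (K : Set (Cn k)) : K ⊆ hull P K :=
  fun z hz u _ => le_iSup₂ (f := fun y (_ : y ∈ K) => (u y : EReal)) z hz

theorem isClosed_hull (hP : ∀ u ∈ P, Continuous u) (K : Set (Cn k)) : IsClosed (hull P K) := by
  simp only [hull, Set.ofPred_forall]
  exact isClosed_biInter fun u hu =>
    isClosed_le (continuous_coe_real_ereal.comp (hP u hu)) continuous_const

theorem le_of_mem_hull {x : Cn k} (hx : x ∈ hull P K) {u : Cn k → ℝ} (hu : u ∈ P) {c : ℝ}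
    (h : ∀ y ∈ K, u y ≤ c) : u x ≤ c :=
  EReal.coe_le_coe_iff.1 <|
    (hx u hu).trans (iSup₂_le fun y hy => EReal.coe_le_coe_iff.2 (h y hy))

theorem exists_forall_lt_of_notMem_hull {x : Cn k} (hx : x ∉ hull P K) :
    ∃ u ∈ P, ∃ a < u x, ∀ y ∈ K, u y < a := by
  simp only [hull, Set.mem_ofPred_eq, not_forall, not_le] at hx
  obtain ⟨u, hu, hux⟩ := hx
  obtain ⟨a, hKa, hax⟩ := EReal.lt_iff_exists_real_btwn.1 hux
  exact ⟨u, hu, a, EReal.coe_lt_coe_iff.1 hax, fun y hy => EReal.coe_lt_coe_iff.1 <|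
    (le_iSup₂ (f := fun y (_ : y ∈ K) => (u y : EReal)) y hy).trans_lt hKa⟩

theorem isCompact_frontier_inter_hull_union_inter {U : Set (Cn k)} (hP : ∀ u ∈ P, Continuous u)
    (hK : IsClosed K) (hUc : IsCompact (closure U)) :
    IsCompact ((frontier U ∩ hull P K) ∪ (U ∩ K)) := by
  have hfrontier : frontier U ∩ K ⊆ frontier U ∩ hull P K :=
    Set.inter_subset_inter_right _ (subset_hull P K)
  have heq : (frontier U ∩ hull P K) ∪ (U ∩ K) = (frontier U ∩ hull P K) ∪ (closure U ∩ K) := by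
    rw [closure_eq_self_union_frontier, Set.union_inter_distrib_right, Set.union_comm (U ∩ K),
      ← Set.union_assoc, Set.union_eq_left.2 hfrontier]
  rw [heq]
  exact ((hUc.of_isClosed_subset isClosed_frontier frontier_subset_closure).inter_right
    (isClosed_hull hP K)).union (hUc.inter_right hK)

end Hull

theorem exists_forall_lt_of_antitone_of_tendsto {X ι : Type*} [TopologicalSpace X] [Preorder ι]
    [IsDirectedOrder ι] [Nonempty ι] {S : Set X} (hS : IsCompact S) {u : ι → X → ℝ}
    (hu : ∀ i, Continuous (u i)) (hanti : Antitone u) {v : X → EReal}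
    (hlim : ∀ z ∈ S, Tendsto (fun i => (u i z : EReal)) atTop (𝓝 (v z))) {c : ℝ}
    (hvc : ∀ z ∈ S, v z < c) : ∃ i, ∀ z ∈ S, u i z < c := by
  refine hS.elim_directed_cover (fun i => {z | u i z < c})
    (fun i => isOpen_lt (hu i) continuous_const) (fun z hz => ?_)
    (directed_of_isDirected_le fun i j hij z hz => (hanti hij z).trans_lt hz)
  obtain ⟨i, hi⟩ := ((hlim z hz).eventually (eventually_lt_nhds (hvc z hz))).exists
  exact Set.mem_iUnion.2 ⟨i, EReal.coe_lt_coe_iff.1 hi⟩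

/-- A convex cone of continuous functions which contains the constants, is stable under `regMax`
and is local: the abstract setting for the local maximum principle. -/
structure IsMaxStableCone (P : Set (Cn k → ℝ)) : Prop where
  continuous : ∀ u ∈ P, Continuous u
  const_mem : ∀ c : ℝ, (fun _ => c) ∈ P
  add_mem : ∀ u ∈ P, ∀ w ∈ P, u + w ∈ P
  smul_mem : ∀ c : ℝ, 0 ≤ c → ∀ u ∈ P, c • u ∈ P
  regMax_mem : ∀ u ∈ P, ∀ w ∈ P, (fun z => regMax (u z) (w z)) ∈ P
  mem_of_eventuallyEq : ∀ u, (∀ z, ∃ g ∈ P, u =ᶠ[𝓝 z] g) → u ∈ P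

theorem isMaxStableCone_leviCone {n : WithTop ℕ∞} (hn : 2 ≤ n) (hn' : n ≤ ∞)
    (Γ : Cn k → Set (Cn k)) : IsMaxStableCone (leviCone n Γ) where
  continuous _ hu := hu.1.continuous
  const_mem := const_mem_leviCone
  add_mem _ hu _ hw := add_mem_leviCone hn hu hw
  smul_mem _ hc _ hu := const_smul_mem_leviCone hn hc hu
  regMax_mem _ hu _ hw := regMax_mem_leviCone hn hn' hu hw
  mem_of_eventuallyEq _ := mem_leviCone_of_eventuallyEq

namespace IsMaxStableCone

variable {P : Set (Cn k → ℝ)} {K U : Set (Cn k)}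

theorem piecewise_regMax_mem (hP : IsMaxStableCone P) [DecidablePred (· ∈ U)] {v w : Cn k → ℝ}
    (hv : v ∈ P) (hw : w ∈ P) (hlt : ∀ y ∈ frontier U, v y < w y) :
    U.piecewise (fun z => regMax (v z) (w z)) w ∈ P := by
  refine hP.mem_of_eventuallyEq _ fun z => ?_
  by_cases hzU : z ∈ interior U
  · refine ⟨_, hP.regMax_mem v hv w hw, ?_⟩
    exact (U.piecewise_eqOn _ w).eventuallyEq_of_mem (mem_interior_iff_mem_nhds.1 hzU)
  refine ⟨w, hw, ?_⟩
  by_cases hzc : z ∈ closure U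
  · filter_upwards [(isOpen_lt (hP.continuous v hv) (hP.continuous w hw)).mem_nhds
      (hlt z ⟨hzc, hzU⟩)] with y (hy : v y < w y)
    simp [Set.piecewise, regMax_of_le hy.le]
  · filter_upwards [isClosed_closure.isOpen_compl.mem_nhds hzc] with y hy
    exact U.piecewise_eq_of_notMem _ _ fun h => hy (subset_closure h)

theorem exists_nonneg_lt_of_notMem_hull (hP : IsMaxStableCone P) {x : Cn k} (hx : x ∉ hull P K)
    (M : ℝ) :
    ∃ g ∈ P, 0 ≤ g ∧ Set.EqOn g 0 K ∧ M < g x := by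
  obtain ⟨u, hu, a, hax, hKa⟩ := exists_forall_lt_of_notMem_hull hx
  let g : Cn k → ℝ := (fun z => regMax (u z) a) + fun _ => -a
  have hg : g ∈ P := hP.add_mem _ (hP.regMax_mem u hu _ (hP.const_mem a)) _ (hP.const_mem (-a))
  have hg₀ : 0 ≤ g := fun z => by simpa [g] using right_le_regMax (u z) a
  have hgK : Set.EqOn g 0 K := fun y hy => by simp [g, regMax_of_le (hKa y hy).le]
  have hgx : 0 < g x := by simpa [g] using right_lt_regMax hax
  have hscale : 0 ≤ (|M| + 1) / g x := by positivity
  refine ⟨_, hP.smul_mem _ hscale g hg, smul_nonneg hscale hg₀, fun y hy => ?_, ?_⟩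
  · simp [hgK hy]
  · rw [Pi.smul_apply, smul_eq_mul, div_mul_cancel₀ _ hgx.ne']
    linarith [le_abs_self M]

theorem exists_nonneg_forall_lt_of_disjoint_hull (hP : IsMaxStableCone P) {B : Set (Cn k)}
    (hB : IsCompact B) (hBK : Disjoint B (hull P K)) {f : Cn k → ℝ} (hf : Continuous f) :
    ∃ g ∈ P, 0 ≤ g ∧ Set.EqOn g 0 K ∧ ∀ y ∈ B, f y < g y := by
  refine hB.induction_on
    (p := fun B => ∃ g ∈ P, 0 ≤ g ∧ Set.EqOn g 0 K ∧ ∀ y ∈ B, f y < g y) ?_ ?_ ?_ ?_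
  · exact ⟨0, hP.const_mem 0, le_rfl, fun _ _ => rfl, fun y hy => hy.elim⟩
  · rintro B B' hBB' ⟨g, hg, hg₀, hgK, hfg⟩
    exact ⟨g, hg, hg₀, hgK, fun y hy => hfg y (hBB' hy)⟩
  · rintro B B' ⟨g, hg, hg₀, hgK, hfg⟩ ⟨g', hg', hg₀', hgK', hfg'⟩
    refine ⟨g + g', hP.add_mem g hg g' hg', add_nonneg hg₀ hg₀', fun y hy => ?_, ?_⟩
    · simp [hgK hy, hgK' hy]
    · rintro y (hy | hy)
      · exact (hfg y hy).trans_le (le_add_of_nonneg_right (hg₀' y))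
      · exact (hfg' y hy).trans_le (le_add_of_nonneg_left (hg₀ y))
  · intro y hy
    obtain ⟨g, hg, hg₀, hgK, hfg⟩ :=
      hP.exists_nonneg_lt_of_notMem_hull (Set.disjoint_left.1 hBK hy) (f y)
    exact ⟨{z | f z < g z}, mem_nhdsWithin_of_mem_nhds
      ((isOpen_lt hf (hP.continuous g hg)).mem_nhds hfg), g, hg, hg₀, hgK, fun _ hz => hz⟩

theorem exists_barrier (hP : IsMaxStableCone P) (hUc : IsCompact (closure U)) {v : Cn k → ℝ}
    (hv : Continuous v) {c : ℝ} (hvc : ∀ y ∈ frontier U ∩ hull P K, v y < c) :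
    ∃ w ∈ P, (∀ z, c ≤ w z) ∧ (∀ y ∈ K, w y = c) ∧ ∀ y ∈ frontier U, v y < w y := by
  have hB : IsCompact (frontier U ∩ {y | c ≤ v y}) :=
    (hUc.of_isClosed_subset isClosed_frontier frontier_subset_closure).inter_right
      (isClosed_le continuous_const hv)
  have hBK : Disjoint (frontier U ∩ {y | c ≤ v y}) (hull P K) :=
    Set.disjoint_left.2 fun y hy hyK => (hvc y ⟨hy.1, hyK⟩).not_ge hy.2
  obtain ⟨g, hg, hg₀, hgK, hgB⟩ :=
    hP.exists_nonneg_forall_lt_of_disjoint_hull hB hBK (hv.sub (continuous_const (y := c)))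
  refine ⟨g + fun _ => c, hP.add_mem g hg _ (hP.const_mem c),
    fun z => le_add_of_nonneg_left (hg₀ z), fun y hy => by simp [hgK hy], fun y hy => ?_⟩
  rcases lt_or_ge (v y) c with h | h
  · exact h.trans_le (le_add_of_nonneg_left (hg₀ y))
  · exact sub_lt_iff_lt_add.1 (hgB y ⟨hy, h⟩)

theorem le_of_forall_lt (hP : IsMaxStableCone P) (hUc : IsCompact (closure U)) {v : Cn k → ℝ}
    (hv : v ∈ P) {c : ℝ} (hvc : ∀ y ∈ (frontier U ∩ hull P K) ∪ (U ∩ K), v y < c) {x : Cn k}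
    (hx : x ∈ U ∩ hull P K) : v x ≤ c := by
  classical
  obtain ⟨w, hw, hcw, hwK, hvw⟩ :=
    hP.exists_barrier hUc (hP.continuous v hv) fun y hy => hvc y (Or.inl hy)
  have hglueK : ∀ y ∈ K, U.piecewise (fun z => regMax (v z) (w z)) w y ≤ c := fun y hy => by
    by_cases hyU : y ∈ U
    · have hvy : v y ≤ w y := (hvc y (Or.inr ⟨hyU, hy⟩)).le.trans (hcw y)
      rw [Set.piecewise_eq_of_mem _ _ _ hyU, regMax_of_le hvy, hwK y hy]
    · rw [Set.piecewise_eq_of_notMem _ _ _ hyU, hwK y hy]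
  have hmax : regMax (v x) (w x) ≤ c := by
    have h := le_of_mem_hull hx.2 (hP.piecewise_regMax_mem hv hw hvw) hglueK
    rwa [Set.piecewise_eq_of_mem _ _ _ hx.1] at h
  have hvx : v x ≤ w x := le_of_not_gt fun h => ((hcw x).trans_lt (right_lt_regMax h)).not_ge hmax
  exact hvx.trans ((right_le_regMax (v x) (w x)).trans hmax)

theorem le_iSup_of_mem_decreasingLimits (hP : IsMaxStableCone P) (hK : IsClosed K)
    (hUc : IsCompact (closure U)) {v : Cn k → EReal} (hv : v ∈ decreasingLimits P) {x : Cn k}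
    (hx : x ∈ U ∩ hull P K) :
    v x ≤ ⨆ y ∈ (frontier U ∩ hull P K) ∪ (U ∩ K), v y := by
  obtain ⟨u, hu, hanti, hlim⟩ := hv
  refine EReal.le_of_forall_lt_iff_le.1 fun c hc => ?_
  obtain ⟨m, hm⟩ := exists_forall_lt_of_antitone_of_tendsto
    (isCompact_frontier_inter_hull_union_inter hP.continuous hK hUc)
    (fun i => hP.continuous _ (hu i)) hanti (fun z _ => hlim z)
    fun y hy => (le_iSup₂ (f := fun y _ => v y) y hy).trans_lt hc
  have hvm : v x ≤ u m x :=
    Antitone.le_of_tendsto (fun i j hij => EReal.coe_le_coe_iff.2 (hanti hij x)) (hlim x) m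
  exact hvm.trans (EReal.coe_le_coe_iff.2 (hP.le_of_forall_lt hUc (hu m) hm hx))

end IsMaxStableCone

end GammaHull

theorem corollary3p6_general {k : ℕ} {n : WithTop ℕ∞} (hn : 2 ≤ n) (hn' : n ≤ ∞)
    (Γ : GammaHull.Cn k → Set (GammaHull.Cn k)) {K U : Set (GammaHull.Cn k)} (hK : IsClosed K)
    (hUc : IsCompact (closure U)) {v : GammaHull.Cn k → EReal}
    (hv : v ∈ GammaHull.decreasingLimits (GammaHull.leviCone n Γ)) {x : GammaHull.Cn k}
    (hx : x ∈ U ∩ GammaHull.hull (GammaHull.leviCone n Γ) K) :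
    v x ≤ ⨆ y ∈ (frontier U ∩ GammaHull.hull (GammaHull.leviCone n Γ) K) ∪ (U ∩ K), v y :=
  (GammaHull.isMaxStableCone_leviCone hn hn' Γ).le_iSup_of_mem_decreasingLimits hK hUc hv hx

theorem corollary3p6 (k : ℕ) (K U : Set (GammaHull.Cn k)) (hK : IsCompact K)
    (hU : IsOpen U) (hUc : IsCompact (closure U)) :
    (∀ Γ : GammaHull.Cn k → Set (GammaHull.Cn k), GammaHull.IsClosedConeField Γ →
      ∀ v ∈ GammaHull.decreasingLimits (GammaHull.coneP Γ),
      ∀ x ∈ U ∩ GammaHull.hull (GammaHull.coneP Γ) K,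
        v x ≤ ⨆ y ∈ (frontier U ∩ GammaHull.hull (GammaHull.coneP Γ) K) ∪ (U ∩ K), v y) ∧
    (∀ v ∈ GammaHull.decreasingLimits (GammaHull.smoothPsh k),
      ∀ x ∈ U ∩ GammaHull.hull (GammaHull.smoothPsh k) K,
        v x ≤ ⨆ y ∈ (frontier U ∩ GammaHull.hull (GammaHull.smoothPsh k) K) ∪ (U ∩ K), v y) := by
  rw [GammaHull.smoothPsh_eq_leviCone]
  exact ⟨fun Γ _ _ hv _ => corollary3p6_general le_rfl ENat.LEInfty.out Γ hK.isClosed hUc hv,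
    fun _ hv _ => corollary3p6_general ENat.LEInfty.out le_rfl _ hK.isClosed hUc hv⟩
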